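/- **Theorem 1.1.** Let $G$ be a finite generalized dihedral group generated by $A$ and $t$, i.e. $A$ is an abelian subgroup of index $2$ in the finite group $G$ and $t\in G\setminus A$ is an involution with $tat=a^{-1}$ for all $a\in A$. Let $S\subseteq G\setminus\{e\}$ be inverse-closed with $|S|=4$ and $t\in S$, and suppose that the Cayley graph $\Gamma=\mathrm{Cay}(G,S)$ (vertex set $G$, with $x,y$ adjacent when $yx^{-1}\in S$) is connected. A perfect code in $\Gamma$ is a set $D\subseteq G$ such that for every vertex $x$ there is exactly one vertex of $D$ that is equal or adjacent to $x$. For an integer $k$ let $\sigma(k)=(1-(-1)^k)/2$, and let $o(g)$ denote the order of $g$. Then $\Gamma$ admits a perfect code if and only if at least one of the following holds. 1. There are $s_0,s_1\in A$ such that $S=\{s_1,s_1^{-1},t,ts_0\}$ and, with $n=o(s_0)$ and $m$ the minimum positive integer such that $s_1^m\in\langle s_0\rangle$, one has $5\mid n$ and there is $u\in\{0,2,4,\ldots,2(n/5-1)\}$ such that $s_1^m=s_0^{5u/2+m}$ or $s_1^m=s_0^{5u/2-m}$. 2. There are $s_0,s_1,s_2\in A$ such that $S=\{t,ts_0,ts_1,ts_2\}$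 and, with $n=o(s_0)$, $m$ the minimum positive integer such that $s_1^m\in\langle s_0\rangle$, and $l$ the minimum positive integer such that $s_2^l\in\langle s_0,s_1\rangle$, one has $5\mid n$ and there are $v\in\{2,3,4\}$, integers $a,b$ with $\{a,b\}=\{2+\sigma(v),\,v-\sigma(v)-1\}$, $\alpha_1,\alpha_2\in\{0,1,\ldots,n/5-1\}$ and $j\in\{0,1,\ldots,m-1\}$ such that $$s_1^m=s_0^{5\alpha_1-am}\quad\text{and}\quad s_2^l=s_0^{5\alpha_2-bl+aj}s_1^j.$$ -/

import Mathlib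

/-- `G` is the generalized dihedral group generated by the abelian subgroup `A` of index two and
the involution `t` outside `A`, which inverts every element of `A`. -/
structure IsGeneralizedDihedral {G : Type*} [Group G] (A : Subgroup G) (t : G) : Prop where
  comm : ∀ a ∈ A, ∀ b ∈ A, a * b = b * a
  index_eq : A.index = 2
  not_mem : t ∉ A
  orderOf_eq : orderOf t = 2
  conj : ∀ a ∈ A, t * a * t = a⁻¹

/-- The Cayley graph `Cay(G, S)` of an inverse-closed set `S` not containing the identity:
`x` and `y` are adjacent when `y * x⁻¹ ∈ S`. -/
def cayleyGraph {G : Type*} [Group G] (S : Set G) (hone : (1 : G) ∉ S)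
    (hinv : ∀ s ∈ S, s⁻¹ ∈ S) : SimpleGraph G where
  Adj x y := y * x⁻¹ ∈ S
  symm := ⟨fun x y h => by
    have h' := hinv _ h
    rwa [mul_inv_rev, inv_inv] at h'⟩
  loopless := ⟨fun x h => hone (by rwa [mul_inv_cancel] at h)⟩

/-- A set `D` of vertices is a perfect code if every vertex is dominated by exactly one vertex
of `D`, where `u` dominates `v` if `u = v` or `u` and `v` are adjacent. -/
def IsPerfectCode {V : Type*} (Γ : SimpleGraph V) (D : Set V) : Prop :=
  ∀ v : V, ∃! u : V, u ∈ D ∧ (u = v ∨ Γ.Adj u v)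

/-- `σ(k) = (1 - (-1)^k) / 2`, that is, `0` for even `k` and `1` for odd `k`. -/
def parity (k : ℤ) : ℤ := (1 - (k.negOnePow : ℤ)) / 2

/-- `m` is the minimum positive integer such that `x ^ m ∈ H`. -/
def IsMinPowMem {G : Type*} [Group G] (x : G) (H : Subgroup G) (m : ℕ) : Prop :=
  IsLeast {k : ℕ | 0 < k ∧ x ^ k ∈ H} m

/-- `S = {s₁, s₁⁻¹, t, t s₀}` with `s₀, s₁ ∈ A`, where `n = o(s₀)` is divisible by `5` and
`s₁ ^ m = s₀ ^ (5u/2 ± m)` for some `u ∈ {0, 2, 4, …, 2(n/5 - 1)}`. -/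
def FirstFamily {G : Type*} [Group G] (A : Subgroup G) (t : G) (S : Set G) : Prop :=
  ∃ s₀ ∈ A, ∃ s₁ ∈ A, ∃ n m : ℕ,
    S = {s₁, s₁⁻¹, t, t * s₀} ∧
    orderOf s₀ = n ∧
    IsMinPowMem s₁ (Subgroup.zpowers s₀) m ∧
    5 ∣ n ∧
    ∃ u : ℤ, 0 ≤ u ∧ u ≤ 2 * ((n : ℤ) / 5 - 1) ∧ Even u ∧
      (s₁ ^ m = s₀ ^ (5 * u / 2 + m) ∨ s₁ ^ m = s₀ ^ (5 * u / 2 - m))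

/-- `S = {t, t s₀, t s₁, t s₂}` with `s₀, s₁, s₂ ∈ A`, where `n = o(s₀)` is divisible by `5`,
`s₁ ^ m = s₀ ^ (5α₁ - am)` and `s₂ ^ l = s₀ ^ (5α₂ - bl + aj) s₁ ^ j`, and
`{a, b} = {2 + σ(v), v - σ(v) - 1}` for some `v ∈ {2, 3, 4}`. -/
def SecondFamily {G : Type*} [Group G] (A : Subgroup G) (t : G) (S : Set G) : Prop :=
  ∃ s₀ ∈ A, ∃ s₁ ∈ A, ∃ s₂ ∈ A, ∃ n m l : ℕ,
    S = {t, t * s₀, t * s₁, t * s₂} ∧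
    orderOf s₀ = n ∧
    IsMinPowMem s₁ (Subgroup.zpowers s₀) m ∧
    IsMinPowMem s₂ (Subgroup.closure {s₀, s₁}) l ∧
    5 ∣ n ∧
    ∃ v ∈ ({2, 3, 4} : Set ℤ), ∃ a b : ℤ,
      ({a, b} : Set ℤ) = {2 + parity v, v - parity v - 1} ∧
      ∃ α₁ α₂ j : ℤ,
        (0 ≤ α₁ ∧ α₁ ≤ (n : ℤ) / 5 - 1) ∧
        (0 ≤ α₂ ∧ α₂ ≤ (n : ℤ) / 5 - 1) ∧
        (0 ≤ j ∧ j ≤ (m : ℤ) - 1) ∧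
        s₁ ^ m = s₀ ^ (5 * α₁ - a * m) ∧
        s₂ ^ l = s₀ ^ (5 * α₂ - b * l + a * j) * s₁ ^ j

/-!
A subset of `A` together with a subset of the reflections `t * u` is a pair of functions on the
abelian group `A`. When `S` consists of the reflections `t * c i`, a perfect code is then a code in
the bipartite graph joining `a` to `a + c i`. Counting around a point of the code shows that, after
subtracting `c i`, the code continues along one label `p i` taken twice, that `p` is a four-cycle,
and that the same cycle occurs at all neighbouring points of the code. Hence, with the labels in the
order of the cycle, giving them the weights `1, 3, 4, 2` modulo `5` makes every relation between
the `c i` with coefficient sum zero have weight zero. When `S = {s, s⁻¹, t, t * x}`, the Cayley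
graph is covered by the square grid, which is the bipartite case with the labels `±x`, `±y`. No
other `S` occurs: an involution `z ∈ S ∩ A` is central, and folding the code along `z` gives a
counting contradiction.

Such a divisibility of all relations is equivalent to the congruences in the two families.
Conversely it makes the weight modulo `5` well defined on the subgroup generated by the elements
of `A` that occur in `S`, hence on each of its cosets, and the elements of weight zero form a
perfect code.
-/

/-- A perfect code in the bipartite graph on two copies of `B` in which `a` in the first copy is
joined to `a + c i` in the second one for every `i`, given by the indicator functions `f` and `g`
of its two halves. For `f = g` and labels closed under negation, this is a perfect code of the
Cayley graph of `B`. -/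
structure IsBipartiteCode {ι B : Type*} [Fintype ι] [AddCommGroup B] (f g : B → ℕ) (c : ι → B) :
    Prop where
  left : ∀ a, f a + ∑ i, g (a + c i) = 1
  right : ∀ a, g a + ∑ i, f (a - c i) = 1

namespace IsBipartiteCode

variable {ι B : Type*} [Fintype ι] [AddCommGroup B] {f g : B → ℕ} {c : ι → B} {a b b' : B}
  {i j : ι}

theorem swap (h : IsBipartiteCode f g c) : IsBipartiteCode g f (-c) where
  left a := by simpa only [Pi.neg_apply, ← sub_eq_add_neg] using h.right a
  right a := by simpa only [Pi.neg_apply, sub_neg_eq_add] using h.left a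

theorem reindex (h : IsBipartiteCode f g c) (σ : Equiv.Perm ι) : IsBipartiteCode f g (c ∘ σ) where
  left a := (congrArg (f a + ·) (Equiv.sum_comp σ fun i => g (a + c i))).trans (h.left a)
  right a := (congrArg (g a + ·) (Equiv.sum_comp σ fun i => f (a - c i))).trans (h.right a)

theorem apply_add_eq_zero (h : IsBipartiteCode f g c) (ha : f a = 1) (i : ι) : g (a + c i) = 0 := by
  have hle := Finset.single_le_sum (f := fun i => g (a + c i)) (fun _ _ => Nat.zero_le _)
    (Finset.mem_univ i)
  have := h.left a
  omega

theorem ne_add (h : IsBipartiteCode f g c) (ha : f a = 1) (hb : g b = 1) (i : ι) :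
    b ≠ a + c i := by
  rintro rfl
  exact absurd (h.apply_add_eq_zero ha i) (by omega)

theorem eq_of_sub_eq_sub (h : IsBipartiteCode f g c) (hb : g b = 1) (hb' : g b' = 1)
    (hij : b - c i = b' - c j) : i = j := by
  by_contra hne
  have hle := Finset.add_le_sum (f := fun k => g (b - c i + c k)) (fun _ _ => Nat.zero_le _)
    (Finset.mem_univ i) (Finset.mem_univ j) hne
  have hleft := h.left (b - c i)
  have hj : b - c i + c j = b' := by rw [hij, sub_add_cancel]
  simp only [hj, sub_add_cancel, hb, hb'] at hle
  omega

theorem sum_erase [DecidableEq ι] (h : IsBipartiteCode f g c) (ha : f a = 1) (hij : i ≠ j) :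
    ∑ k ∈ Finset.univ.erase j, g (a + c i + c k - c j) = 1 := by
  have hf : f (a + c i - c j) ≠ 1 := fun hf =>
    hij (h.swap.eq_of_sub_eq_sub (b := a) (b' := a + c i - c j) ha hf (by simp))
  have hleft := h.left (a + c i - c j)
  rw [← Finset.add_sum_erase _ _ (Finset.mem_univ j), sub_add_cancel,
    h.apply_add_eq_zero ha] at hleft
  simp only [sub_add_eq_add_sub] at hleft
  omega

end IsBipartiteCode

/-- Near the point `a` of a bipartite code with four labels, the point at distance three that is
reached by subtracting `c i` and adding one label twice is `a + 2 c (p i) - c i`, so that the point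
reached by subtracting `c i` and adding two other labels avoids the label `c (p i)`. -/
structure HasTurnAt {B : Type*} [AddCommGroup B] (f g : B → ℕ) (c : Fin 4 → B)
    (p : Fin 4 → Fin 4) (a : B) : Prop where
  self : f a = 1
  double : ∀ i, g (a + c (p i) + c (p i) - c i) = 1
  pair : ∀ i k l, [i, p i, k, l].Nodup → g (a + c k + c l - c i) = 1

section FourLabels

variable {B : Type*} [AddCommGroup B] {f g : B → ℕ} {c : Fin 4 → B} {a : B}

theorem exists_nodup_of_ne : ∀ {i j : Fin 4}, j ≠ i → ∃ k l, [i, j, k, l].Nodup := by decide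

theorem exists_nodup_of_ne_of_ne :
    ∀ {i j k : Fin 4}, j ≠ i → k ≠ i → k ≠ j → ∃ l, [i, j, k, l].Nodup := by decide

theorem nodup_add_one : ∀ i : Fin 4, [i, i + 1, i + 2, i + 3].Nodup := by decide

set_option maxRecDepth 10000 in
theorem eq_succ_or : ∀ q : Fin 4 → Fin 4, q.Injective → (∀ j, q j ≠ j) → (∀ j, q (q j) ≠ j) →
    ∀ i, q i = i + 1 → (∀ j, q j = j + 1) ∨ q (i + 1) = i + 3 ∧ q (i + 2) = i := by
  decide

set_option maxRecDepth 10000 in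
theorem exists_perm_succ : ∀ p : Fin 4 → Fin 4, p.Injective → (∀ i, p i ≠ i) →
    (∀ i, p (p i) ≠ i) → ∃ σ : Equiv.Perm (Fin 4), σ 0 = 0 ∧ ∀ i, p (σ i) = σ (i + 1) := by
  decide

theorem sum_erase_of_nodup {M : Type*} [AddCommMonoid M] (F : Fin 4 → M) {i j k l : Fin 4}
    (h : [i, j, k, l].Nodup) : ∑ m ∈ Finset.univ.erase i, F m = F j + F k + F l := by
  have herase : Finset.univ.erase i = {j, k, l} := by decide +revert
  simp only [List.nodup_cons, List.mem_cons, List.not_mem_nil, or_false, not_or] at h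
  rw [herase, Finset.sum_insert (by simp [h]), Finset.sum_insert (by simp [h]),
    Finset.sum_singleton, add_assoc]

theorem IsBipartiteCode.exists_double (h : IsBipartiteCode f g c) (ha : f a = 1) (i : Fin 4) :
    ∃ j ≠ i, g (a + c j + c j - c i) = 1 := by
  have h₁ : i + 1 ≠ i := by simp
  have h₂ : i + 2 ≠ i := by simp
  have h₃ : i + 3 ≠ i := by simp
  have row {j : Fin 4} (hj : j ≠ i) := (sum_erase_of_nodup (fun k => g (a + c j + c k - c i))
    (nodup_add_one i)).symm.trans (h.sum_erase ha hj)
  have row₁ := row h₁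
  have row₂ := row h₂
  have row₃ := row h₃
  rw [add_right_comm a (c (i + 2)) (c (i + 1))] at row₂
  rw [add_right_comm a (c (i + 3)) (c (i + 1)), add_right_comm a (c (i + 3)) (c (i + 2))] at row₃
  by_contra! hne
  have hne₁ := hne _ h₁
  have hne₂ := hne _ h₂
  have hne₃ := hne _ h₃
  omega

/-- Two turns of the labels `i` and `p i` into each other would put two points of the code next to
`a + c k + c l - c i - c (p i)`. -/
theorem IsBipartiteCode.exists_hasTurnAt (h : IsBipartiteCode f g c) (ha : f a = 1) :
    ∃ p : Fin 4 → Fin 4, p.Injective ∧ (∀ i, p i ≠ i) ∧ (∀ i, p (p i) ≠ i) ∧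
      HasTurnAt f g c p a := by
  choose p hpne hp using h.exists_double ha
  have hinj : p.Injective := fun i j hij =>
    (h.eq_of_sub_eq_sub (hp i) (hp j) (by rw [hij]; abel)).symm
  have hpair : ∀ i k l, [i, p i, k, l].Nodup → g (a + c k + c l - c i) = 1 := by
    intro i k l hnd
    have hk : g (a + c k + c k - c i) ≠ 1 := by
      intro hk
      obtain ⟨j, rfl⟩ := Finite.surjective_of_injective hinj k
      have := h.eq_of_sub_eq_sub (i := j) (j := i) hk (hp j) (by abel)
      simp [this] at hnd
    have hpk : g (a + c k + c (p i) - c i) ≠ 1 := by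
      intro hpk
      have := h.eq_of_sub_eq_sub (i := k) (j := p i) hpk (hp i) (by abel)
      simp [this] at hnd
    have hsum := h.sum_erase ha (i := k) (j := i) (by rintro rfl; simp at hnd)
    rw [sum_erase_of_nodup _ hnd] at hsum
    omega
  refine ⟨p, hinj, hpne, fun i hi => ?_, ha, hp, hpair⟩
  obtain ⟨k, l, hkl⟩ := exists_nodup_of_ne (hpne i)
  have h₁ := hpair i k l hkl
  have h₂ := hpair (p i) k l (by rw [hi]; exact (List.Perm.swap _ _ _).nodup hkl)
  exact hpne i (h.eq_of_sub_eq_sub h₁ h₂ (by abel))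

namespace HasTurnAt

theorem comp_equiv {p q : Fin 4 → Fin 4} (ha : HasTurnAt f g c p a) {σ : Equiv.Perm (Fin 4)}
    (hσ : ∀ i, p (σ i) = σ (q i)) : HasTurnAt f g (c ∘ σ) q a where
  self := ha.self
  double i := by simpa only [hσ, Function.comp_apply] using ha.double (σ i)
  pair i k l hnd := ha.pair _ _ _ <| by
    simpa only [hσ, List.map_cons, List.map_nil] using hnd.map σ.injective

theorem eq_of_double {p : Fin 4 → Fin 4} (h : IsBipartiteCode f g c) (ha : HasTurnAt f g c p a)
    {i k : Fin 4} (hpi : p i ≠ i) (hk : k ≠ i) (hg : g (a + c k + c k - c i) = 1) : p i = k := by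
  by_contra hne
  obtain ⟨l, hl⟩ := exists_nodup_of_ne_of_ne hpi hk (Ne.symm hne)
  have := h.eq_of_sub_eq_sub (i := k) (j := l) hg (ha.pair i k l hl) (by abel)
  simp [this] at hl

theorem ne_of_pair {p : Fin 4 → Fin 4} (h : IsBipartiteCode f g c) (ha : HasTurnAt f g c p a)
    {i k l : Fin 4} (hkl : k ≠ l) (hg : g (a + c k + c l - c i) = 1) : p i ≠ k := by
  rintro rfl
  exact hkl (h.eq_of_sub_eq_sub (ha.double i) hg (by abel))

theorem not_apply_add_sub (h : IsBipartiteCode f g c) (ha : HasTurnAt f g c (· + 1) a)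
    (i : Fin 4) : f (a + c (i + 1) + c (i + 2) - c (i + 3) - c i) ≠ 1 := by
  intro hf
  have hnd : [i + 3, i + 3 + 1, i + 1, i + 2].Nodup := by clear hf; decide +revert
  exact h.ne_add hf (ha.pair _ _ _ hnd) i (sub_add_cancel _ _).symm

theorem succ_double (h : IsBipartiteCode f g c) (ha : HasTurnAt f g c (· + 1) a) (i : Fin 4) :
    HasTurnAt g f (-c) (· + 1) (a + c (i + 1) + c (i + 1) - c i) := by
  obtain ⟨q, hinj, hne, hne₂, hq⟩ := h.swap.exists_hasTurnAt (ha.double i)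
  have hqi : q i = i + 1 := hq.eq_of_double h.swap (hne i) (by simp) <| by
    convert ha.self using 2
    simp only [Pi.neg_apply]
    abel
  rcases eq_succ_or q hinj hne hne₂ i hqi with hsucc | ⟨-, hq₂⟩
  · rwa [funext hsucc] at hq
  · have hnd : [i + 2, q (i + 2), i + 1, i + 3].Nodup := by rw [hq₂]; clear * -; decide +revert
    refine absurd ?_ (not_apply_add_sub h ha i)
    convert hq.pair _ _ _ hnd using 2
    simp only [Pi.neg_apply]
    abel

theorem succ_pair (h : IsBipartiteCode f g c) (ha : HasTurnAt f g c (· + 1) a) (i : Fin 4) :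
    HasTurnAt g f (-c) (· + 1) (a + c (i + 2) + c (i + 3) - c i) := by
  obtain ⟨q, hinj, hne, hne₂, hq⟩ :=
    h.swap.exists_hasTurnAt (ha.pair i (i + 2) (i + 3) (nodup_add_one i))
  have hq₂ : q i ≠ i + 2 := hq.ne_of_pair h.swap (l := i + 3) (by simp) <| by
    convert ha.self using 2
    simp only [Pi.neg_apply]
    abel
  have hq₃ : q i ≠ i + 3 := hq.ne_of_pair h.swap (l := i + 2) (by simp) <| by
    convert ha.self using 2
    simp only [Pi.neg_apply]
    abel
  have hqi : q i = i + 1 := by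
    have hqi := hne i
    generalize q i = j at *
    clear * - hqi hq₂ hq₃
    decide +revert
  rcases eq_succ_or q hinj hne hne₂ i hqi with hsucc | ⟨hq₁, -⟩
  · rwa [funext hsucc] at hq
  · refine absurd ?_ (not_apply_add_sub h ha i)
    convert hq.double (i + 1) using 2
    rw [hq₁]
    simp only [Pi.neg_apply]
    abel

end HasTurnAt

/-- The powers of `3` modulo `5`: the weights of the labels of a bipartite code all of whose turns
are `i ↦ i + 1`. -/
def cyclicWeight : Fin 4 → ZMod 5 := ![1, 3, 4, 2]

/-- The vertex `a` has weight `k` modulo `5`, where the weight changes by `cyclicWeight i` along the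
label `c i` and vanishes on the code. On the second half the weight is that of the swapped code,
which is the opposite. -/
def IsWeightAt (f g : B → ℕ) (c : Fin 4 → B) (a : B) (k : ZMod 5) : Prop :=
  HasTurnAt f g c (· + 1) a ∧ k = 0 ∨
    ∃ i, HasTurnAt g f (-c) (· + 1) (a + c i) ∧ k + cyclicWeight i = 0

namespace IsWeightAt

variable {k : ZMod 5}

theorem eq_zero (h : IsBipartiteCode f g c) (hk : IsWeightAt f g c a k) (ha : f a = 1) : k = 0 := by
  rcases hk with ⟨-, hk⟩ | ⟨i, hi, -⟩
  · exact hk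
  · exact absurd rfl (h.ne_add ha hi.self i)

theorem add_label (h : IsBipartiteCode f g c) (hk : IsWeightAt f g c a k) (j : Fin 4) :
    IsWeightAt g f (-c) (a + c j) (-(k + cyclicWeight j)) := by
  rcases hk with ⟨ha, rfl⟩ | ⟨i, hi, hki⟩
  · exact Or.inr ⟨j, by simpa using ha, by simp⟩
  obtain rfl | hij := eq_or_ne j i
  · exact Or.inl ⟨hi, by rw [hki, neg_zero]⟩
  obtain rfl := eq_neg_of_add_eq_zero_left hki
  have hcases : i = j + 1 ∨ i = j + 2 ∨ i = j + 3 := by clear hi hki; decide +revert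
  refine Or.inr ?_
  rcases hcases with rfl | rfl | rfl
  · refine ⟨j + 1, ?_, by clear * -; decide +revert⟩
    convert hi.succ_double h.swap j using 1
    simp only [Pi.neg_apply]
    abel
  · refine ⟨j + 3, ?_, by clear * -; decide +revert⟩
    convert hi.succ_pair h.swap j using 1
    simp only [Pi.neg_apply]
    abel
  · refine ⟨j + 2, ?_, by clear * -; decide +revert⟩
    convert hi.succ_pair h.swap j using 1
    simp only [Pi.neg_apply]
    abel

theorem add_sub (h : IsBipartiteCode f g c) (hk : IsWeightAt f g c a k) (i j : Fin 4) :
    IsWeightAt f g c (a + (c i - c j)) (k + (cyclicWeight i - cyclicWeight j)) := by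
  convert (hk.add_label h i).add_label h.swap j using 1
  · rw [neg_neg]
  · simp only [Pi.neg_apply]
    abel
  · abel

theorem add_zsmul (h : IsBipartiteCode f g c) (hk : IsWeightAt f g c a k) (i j : Fin 4) (n : ℤ) :
    IsWeightAt f g c (a + n • (c i - c j)) (k + n * (cyclicWeight i - cyclicWeight j)) := by
  induction n with
  | zero => simpa using hk
  | succ n ih =>
    convert ih.add_sub h i j using 1
    · rw [_root_.add_zsmul, one_zsmul, add_assoc]
    · push_cast
      ring
  | pred n ih =>
    convert ih.add_sub h j i using 1
    · rw [sub_zsmul, one_zsmul]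
      abel
    · push_cast
      ring

end IsWeightAt

theorem IsBipartiteCode.exists_perm_five_dvd (h : IsBipartiteCode f g c) (ha : f a = 1) :
    ∃ σ : Equiv.Perm (Fin 4), σ 0 = 0 ∧ ∀ n : Fin 4 → ℤ, ∑ i, n i = 0 →
      f (a + ∑ i, n i • c (σ i)) = 1 → 5 ∣ n 0 + 3 * n 1 + 4 * n 2 + 2 * n 3 := by
  obtain ⟨p, hinj, hne, hne₂, hp⟩ := h.exists_hasTurnAt ha
  obtain ⟨σ, hσ₀, hσ⟩ := exists_perm_succ p hinj hne hne₂
  refine ⟨σ, hσ₀, fun n hn hf => ?_⟩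
  have hcode := h.reindex σ
  have hweight : IsWeightAt f g (c ∘ σ) a 0 := Or.inl ⟨hp.comp_equiv hσ, rfl⟩
  have hsum := ((hweight.add_zsmul hcode 1 0 (n 1)).add_zsmul hcode 2 0 (n 2)).add_zsmul hcode
    3 0 (n 3)
  rw [Fin.sum_univ_four] at hn hf
  have hn₀ : n 0 = -n 1 - n 2 - n 3 := by omega
  have hzero := hsum.eq_zero hcode <| by
    convert hf using 2
    rw [hn₀]
    simp only [Function.comp_apply, smul_sub, sub_smul, neg_smul]
    abel
  refine (ZMod.intCast_zmod_eq_zero_iff_dvd _ 5).mp ?_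
  rw [← hzero, hn₀]
  simp only [cyclicWeight, Matrix.cons_val]
  push_cast
  ring

end FourLabels

section Grid

variable {B : Type*} [AddCommGroup B]

theorem eq_one_or_swap_of_alternating : ∀ σ : Equiv.Perm (Fin 4), σ 0 = 0 →
    let n := ![1, -1, 1, -1] ∘ σ
    (5 : ℤ) ∣ n 0 + 3 * n 1 + 4 * n 2 + 2 * n 3 → σ = 1 ∨ σ = Equiv.swap 1 3 := by
  decide

/-- The relation `x - y + (-x) - (-y) = 0` between the four labels of a square grid forces opposite
labels to have opposite weights. -/
theorem five_dvd_of_grid {f : B → ℕ} {x y a : B}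
    (h : ∀ b, f b + f (b + x) + f (b - x) + f (b + y) + f (b - y) = 1) (ha : f a = 1) :
    (∀ i j : ℤ, f (a + ((2 * i) • x + (2 * j) • y)) = 1 → 5 ∣ i + 2 * j) ∨
      ∀ i j : ℤ, f (a + ((2 * i) • x + (2 * j) • y)) = 1 → 5 ∣ i - 2 * j := by
  have hcode : IsBipartiteCode f f ![x, y, -x, -y] := by
    constructor <;> intro b <;> rw [← h b, Fin.sum_univ_four] <;>
      simp only [Matrix.cons_val, ← sub_eq_add_neg, sub_neg_eq_add] <;> ring
  obtain ⟨σ, hσ₀, hσ⟩ := hcode.exists_perm_five_dvd ha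
  have relation (n : Fin 4 → ℤ) (hn : ∑ i, n i = 0)
      (hf : f (a + ∑ i, n i • ![x, y, -x, -y] i) = 1) :=
    hσ (n ∘ σ) ((Equiv.sum_comp σ n).trans hn) (by rwa [← Equiv.sum_comp σ] at hf)
  have relation' (i j : ℤ) (hf : f (a + ((2 * i) • x + (2 * j) • y)) = 1) :=
    relation ![i, j, -i, -j] (by simp [Fin.sum_univ_four]) <| by
      convert hf using 2
      simp only [Fin.sum_univ_four, Matrix.cons_val, two_mul, add_smul, smul_neg, neg_smul, neg_neg]
      abel
  have alternating := relation ![1, -1, 1, -1] (by decide) (by simpa [Fin.sum_univ_four] using ha)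
  rcases eq_one_or_swap_of_alternating σ hσ₀ alternating with rfl | rfl
  · refine Or.inr fun i j hf => ?_
    have hdvd : 5 ∣ i + 3 * j + 4 * -i + 2 * -j := relation' i j hf
    omega
  · refine Or.inl fun i j hf => ?_
    have hdvd : 5 ∣ i + 3 * -j + 4 * -i + 2 * j := relation' i j hf
    omega

/-- The rungs of the ladder alternate between `b, b` and `b, b + x`, so that unrolling it gives a
square grid in which two steps in the first direction amount to `x`. -/
theorem five_dvd_of_ladder {f g : B → ℕ} {s x : B}
    (hf : ∀ b, f b + f (b + s) + f (b - s) + g b + g (b + x) = 1)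
    (hg : ∀ b, g b + g (b + s) + g (b - s) + f b + f (b - x) = 1) (h₀ : f 0 = 1) :
    (∀ i j : ℤ, i • x + j • s = 0 → 5 ∣ i + j) ∨ ∀ i j : ℤ, i • x + j • s = 0 → 5 ∣ i - j := by
  let F : ℤ × ℤ → ℕ := fun v =>
    if Even v.1 then f ((v.1 / 2) • x + v.2 • s) else g (((v.1 + 1) / 2) • x + v.2 • s)
  have F_even (m j : ℤ) : F (2 * m, j) = f (m • x + j • s) := by simp [F]
  have F_odd (m j : ℤ) : F (2 * m - 1, j) = g (m • x + j • s) := by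
    simp [F]
  have hF : ∀ v, F v + F (v + (1, 0)) + F (v - (1, 0)) + F (v + (0, 1)) + F (v - (0, 1)) = 1 := by
    rintro ⟨i, j⟩
    simp only [Prod.mk_add_mk, Prod.mk_sub_mk, add_zero, sub_zero]
    obtain ⟨m, rfl | rfl⟩ : ∃ m, i = 2 * m ∨ i = 2 * m - 1 := ⟨(i + 1) / 2, by omega⟩
    · rw [show 2 * m + 1 = 2 * (m + 1) - 1 by ring]
      simp only [F_even, F_odd, add_smul, sub_smul, one_smul, ← add_assoc, ← add_sub_assoc,
        add_right_comm _ x]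
      have := hf (m • x + j • s)
      omega
    · rw [sub_add_cancel, show 2 * m - 1 - 1 = 2 * (m - 1) by ring]
      simp only [F_even, F_odd, add_smul, sub_smul, one_smul, ← add_assoc, ← add_sub_assoc,
        sub_add_eq_add_sub]
      have := hg (m • x + j • s)
      omega
  have hF₀ (i j : ℤ) (hij : i • x + j • s = 0) :
      F (0 + ((2 * (2 * i)) • (1, 0) + (2 * j) • (0, 1))) = 1 := by
    have hij₂ : (2 * i) • x + (2 * j) • s = 0 := by
      rw [mul_smul, mul_smul, ← smul_add, hij, smul_zero]
    simp [F_even, hij₂, h₀]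
  refine (five_dvd_of_grid (a := 0) hF (by simpa [F] using h₀)).imp ?_ ?_ <;> intro h i j hij
  · have := h _ _ (hF₀ i j hij)
    omega
  · have := h _ _ (hF₀ i j hij)
    omega

end Grid
section CayleyCode

variable {G : Type*} [Group G] {S : Set G}

theorem isPerfectCode_cayleyGraph_iff {hone : (1 : G) ∉ S} {hinv : ∀ s ∈ S, s⁻¹ ∈ S}
    {D : Set G} :
    IsPerfectCode (cayleyGraph S hone hinv) D ↔ ∀ v, ∃! s, s ∈ insert 1 S ∧ s * v ∈ D := by
  refine forall_congr' fun v => Iff.trans ?_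
    ((Equiv.mulRight v).existsUnique_congr_left (p := fun s => s ∈ insert 1 S ∧ _)).symm
  refine existsUnique_congr fun u => ?_
  have hadj : v * u⁻¹ ∈ S ↔ u * v⁻¹ ∈ S :=
    ⟨fun h => by simpa using hinv _ h, fun h => by simpa using hinv _ h⟩
  simp [cayleyGraph, hadj, and_comm, mul_inv_eq_one]

/-- The indicator function of a perfect code of the Cayley graph of `S` that contains `1`. -/
structure IsCodeIndicator (S : Set G) (χ : G → ℕ) : Prop where
  one : χ 1 = 1
  sum : ∀ g, χ g + ∑ᶠ s ∈ S, χ (s * g) = 1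

theorem IsPerfectCode.exists_isCodeIndicator (hfin : S.Finite) {hone : (1 : G) ∉ S}
    {hinv : ∀ s ∈ S, s⁻¹ ∈ S} {D : Set G} (hD : IsPerfectCode (cayleyGraph S hone hinv) D) :
    ∃ χ : G → ℕ, IsCodeIndicator S χ := by
  rw [isPerfectCode_cayleyGraph_iff] at hD
  obtain ⟨v, -, hv⟩ := (hD 1).exists
  rw [mul_one] at hv
  refine ⟨fun g => D.indicator 1 (g * v), by simp [hv], fun g => ?_⟩
  obtain ⟨s, ⟨hs, hsD⟩, huniq⟩ := hD (g * v)
  have hsum := finsum_mem_insert (fun s => D.indicator (1 : G → ℕ) (s * g * v)) hone hfin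
  rw [one_mul] at hsum
  rw [← hsum, finsum_mem_def, finsum_eq_single _ s]
  · simp [hs, hsD, mul_assoc]
  · intro u hu
    by_contra! hne
    have huS := Set.mem_of_indicator_ne_zero hne
    rw [Set.indicator_of_mem huS, mul_assoc] at hne
    exact hu (huniq u ⟨huS, Set.mem_of_indicator_ne_zero hne⟩)

namespace IsCodeIndicator

variable {χ : G → ℕ}

theorem sum_range (h : IsCodeIndicator S χ) {ι : Type*} [Fintype ι] {s : ι → G}
    (hs : Set.range s = S) (hcard : S.ncard = Fintype.card ι) (g : G) :
    χ g + ∑ i, χ (s i * g) = 1 := by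
  have hinj : s.Injective := by
    rw [← Set.injOn_univ]
    refine Set.injOn_of_ncard_image_eq ?_ Set.finite_univ
    rw [Set.image_univ, hs, hcard, Set.ncard_univ, Nat.card_eq_fintype_card]
  rw [← h.sum g, ← hs, finsum_mem_range hinj, finsum_eq_sum_of_fintype]

theorem sum_four {a b c d : G} (h : IsCodeIndicator {a, b, c, d} χ)
    (hcard : ({a, b, c, d} : Set G).ncard = 4) (g : G) :
    χ g + χ (a * g) + χ (b * g) + χ (c * g) + χ (d * g) = 1 := by
  have hrange : Set.range ![a, b, c, d] = {a, b, c, d} := by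
    simp only [Matrix.range_cons, Matrix.range_empty, Set.union_empty, Set.singleton_union]
  simpa [Fin.sum_univ_four, add_assoc] using h.sum_range hrange hcard g

end IsCodeIndicator

end CayleyCode

namespace IsGeneralizedDihedral

variable {G : Type*} [Group G] {A : Subgroup G} {t : G}

theorem isMulCommutative (hG : IsGeneralizedDihedral A t) : IsMulCommutative A :=
  ⟨⟨fun a b => Subtype.ext (hG.comm a a.2 b b.2)⟩⟩

theorem mul_self (hG : IsGeneralizedDihedral A t) : t * t = 1 := by
  rw [← sq, ← hG.orderOf_eq, pow_orderOf_eq_one]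

theorem mul_mul_cancel (hG : IsGeneralizedDihedral A t) (g : G) : t * (t * g) = g := by
  rw [← mul_assoc, hG.mul_self, one_mul]

theorem mul_mem_iff (hG : IsGeneralizedDihedral A t) {g : G} : t * g ∈ A ↔ g ∉ A := by
  rw [Subgroup.mul_mem_iff_of_index_two hG.index_eq]
  simp only [hG.not_mem, false_iff]

theorem mul_eq_mul_inv (hG : IsGeneralizedDihedral A t) {a g : G} (ha : a ∈ A) (hg : g ∉ A) :
    a * g = g * a⁻¹ := by
  have hat : a * t = t * a⁻¹ := by rw [← hG.conj a ha, mul_assoc, hG.mul_mul_cancel]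
  calc a * g = a * t * (t * g) := by rw [mul_assoc, hG.mul_mul_cancel]
    _ = t * (t * g * a⁻¹) := by
      rw [hat, mul_assoc, hG.comm _ (inv_mem ha) _ (hG.mul_mem_iff.2 hg)]
    _ = g * a⁻¹ := by rw [← mul_assoc, hG.mul_mul_cancel]

theorem mul_mul_mul_eq_inv_mul (hG : IsGeneralizedDihedral A t) {a : G} (ha : a ∈ A) (g : G) :
    t * a * (t * g) = a⁻¹ * g := by
  rw [← mul_assoc, hG.conj a ha]

theorem mul_self_of_notMem (hG : IsGeneralizedDihedral A t) {g : G} (hg : g ∉ A) : g * g = 1 := by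
  have := hG.mul_eq_mul_inv (hG.mul_mem_iff.2 hg) hg
  rwa [mul_inv_rev, mul_inv_cancel_left, inv_eq_of_mul_eq_one_left hG.mul_self, mul_assoc,
    mul_eq_left] at this

theorem commute_of_mul_self (hG : IsGeneralizedDihedral A t) {z : G} (hz : z ∈ A)
    (hzz : z * z = 1) (g : G) : Commute z g := by
  by_cases hg : g ∈ A
  · exact hG.comm z hz g hg
  · have := hG.mul_eq_mul_inv hz hg
    rwa [inv_eq_of_mul_eq_one_left hzz] at this

theorem mul_mul_reverse (hG : IsGeneralizedDihedral A t) {a b c : G}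
    (ha : a ∉ A) (hb : b ∉ A) (hc : c ∉ A) : a * (b * c) = c * (b * a) := by
  have hab : a * b ∈ A := by simp [Subgroup.mul_mem_iff_of_index_two hG.index_eq, ha, hb]
  rw [← mul_assoc, hG.mul_eq_mul_inv hab hc, mul_inv_rev,
    inv_eq_of_mul_eq_one_left (hG.mul_self_of_notMem ha),
    inv_eq_of_mul_eq_one_left (hG.mul_self_of_notMem hb)]

end IsGeneralizedDihedral

section CentralInvolution

variable {G : Type*} [Group G]

/-- The sum of a code indicator over the cosets of a central involution `z` of the connection set
`{z, p, q, r}`, viewed as a function on `G`. -/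
structure IsFoldedCode (p q r : G) (F : G → ℕ) : Prop where
  one : F 1 = 1
  sum : ∀ g, 2 * F g + F (p * g) + F (q * g) + F (r * g) = 2

theorem IsCodeIndicator.exists_isFoldedCode {χ : G → ℕ} {z p q r : G}
    (h : IsCodeIndicator {z, p, q, r} χ) (hcard : ({z, p, q, r} : Set G).ncard = 4)
    (hzz : z * z = 1) (hzc : ∀ g, Commute z g) : ∃ F, IsFoldedCode p q r F := by
  have hsum (g : G) : 2 * (χ g + χ (z * g)) + (χ (p * g) + χ (z * (p * g))) +
      (χ (q * g) + χ (z * (q * g))) + (χ (r * g) + χ (z * (r * g))) = 2 := by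
    have h₁ := h.sum_four hcard g
    have h₂ := h.sum_four hcard (z * g)
    rw [← (hzc p).left_comm, ← (hzc q).left_comm, ← (hzc r).left_comm, ← mul_assoc z z, hzz,
      one_mul] at h₂
    omega
  refine ⟨fun g => χ g + χ (z * g), ?_, hsum⟩
  have := hsum 1
  have := h.one
  rw [mul_one] at *
  omega

namespace IsFoldedCode

variable {p q r : G} {F : G → ℕ}

theorem swap₁₂ (h : IsFoldedCode p q r F) : IsFoldedCode q p r F :=
  ⟨h.one, fun g => by linarith [h.sum g]⟩

theorem swap₂₃ (h : IsFoldedCode p q r F) : IsFoldedCode p r q F :=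
  ⟨h.one, fun g => by linarith [h.sum g]⟩

theorem apply_le_one (h : IsFoldedCode p q r F) (g : G) : F g ≤ 1 := by
  have := h.sum g
  omega

theorem apply_eq_zero (h : IsFoldedCode p q r F) : F p = 0 ∧ F q = 0 ∧ F r = 0 := by
  have := h.sum 1
  simp only [h.one, mul_one] at this
  omega

theorem apply_mul_eq_one (h : IsFoldedCode p q r F) (hp : p * p = 1 ∨ q * p = 1)
    (hr : r * (p * r) = p ∨ r * (p * r) = q) : F (p * r) = 1 := by
  obtain ⟨hFp, hFq, hFr⟩ := h.apply_eq_zero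
  have hpr := h.sum (p * r)
  have hFrpr : F (r * (p * r)) = 0 := by rcases hr with hr | hr <;> rwa [hr]
  have hback : F (p * (p * r)) = 0 ∨ F (q * (p * r)) = 0 := by
    refine hp.imp (fun hp => ?_) fun hp => ?_ <;> rwa [← mul_assoc, hp, one_mul]
  have := h.apply_le_one (p * (p * r))
  have := h.apply_le_one (q * (p * r))
  omega

/-- A ladder with rails `p`, `q` and rung `r` carries no folded code: it would force both
neighbours `p * r` and `q * r` of `r` to take the value one, like `1`. -/
theorem false_of_ladder (h : IsFoldedCode p q r F) (hr : r * r = 1) (hp : p * p = 1 ∨ q * p = 1)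
    (hq : q * q = 1 ∨ p * q = 1) (hrp : r * (p * r) = p ∨ r * (p * r) = q)
    (hrq : r * (q * r) = q ∨ r * (q * r) = p) : False := by
  have hpr := h.apply_mul_eq_one hp hrp
  have hqr := h.swap₁₂.apply_mul_eq_one hq hrq
  have := h.sum r
  rw [hr, h.one] at this
  omega

variable {A : Subgroup G} {t : G}

theorem false_of_involutions (h : IsFoldedCode p q r F) (hG : IsGeneralizedDihedral A t)
    (hr : r ∈ A) (hpp : p * p = 1) (hqq : q * q = 1) (hrr : r * r = 1) : False := by
  have hcomm := hG.commute_of_mul_self hr hrr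
  have hconj (s : G) : r * (s * r) = s := by rw [(hcomm s).symm.eq, ← mul_assoc, hrr, one_mul]
  exact h.false_of_ladder hrr (.inl hpp) (.inl hqq) (.inl (hconj p)) (.inl (hconj q))

theorem false_of_inverse_pair (h : IsFoldedCode p p⁻¹ t F) (hG : IsGeneralizedDihedral A t)
    (hp : p ∈ A) : False := by
  have hconj {s : G} (hs : s ∈ A) : t * (s * t) = s⁻¹ := by rw [← mul_assoc, hG.conj s hs]
  exact h.false_of_ladder hG.mul_self (.inr (inv_mul_cancel p)) (.inr (mul_inv_cancel p))
    (.inr (hconj hp)) (.inr ((hconj (inv_mem hp)).trans (inv_inv p)))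

/-- The products of at most three of the reflections span a piece of the hexagonal tiling, across
which the values are forced until they conflict. -/
theorem apply_mul_ne_one (h : IsFoldedCode p q r F) (hG : IsGeneralizedDihedral A t) (hp : p ∉ A)
    (hq : q ∉ A) (hr : r ∉ A) : F (r * p) ≠ 1 := by
  intro hrp
  have cancel {x : G} (hx : x ∉ A) (y : G) : x * (x * y) = y := by
    rw [← mul_assoc, hG.mul_self_of_notMem hx, one_mul]
  have le := h.apply_le_one
  obtain ⟨hFp, hFq, hFr⟩ := h.apply_eq_zero
  have sum_p := h.sum p
  have sum_q := h.sum q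
  have sum_r := h.sum r
  have sum_rp := h.sum (r * p)
  have sum_rq := h.sum (r * q)
  have sum_pq := h.sum (p * q)
  have sum_pr := h.sum (p * r)
  have sum_qr := h.sum (q * r)
  have sum_qp := h.sum (q * p)
  rw [hG.mul_self_of_notMem hp, h.one] at sum_p
  rw [hG.mul_self_of_notMem hq, h.one] at sum_q
  rw [hG.mul_self_of_notMem hr, h.one] at sum_r
  rw [cancel hr, hG.mul_mul_reverse hq hr hp] at sum_rp
  rw [cancel hr] at sum_rq
  rw [cancel hp] at sum_pq
  rw [cancel hp, hG.mul_mul_reverse hq hp hr] at sum_pr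
  rw [cancel hq] at sum_qr
  rw [cancel hq, hG.mul_mul_reverse hr hq hp] at sum_qp
  have hrq : F (r * q) = 1 := by have := le (q * (r * q)); omega
  have hrpq : F (r * (p * q)) = 1 := by have := le (q * (p * q)); have := le (r * (p * q)); omega
  have hqr : F (q * r) = 1 := by omega
  have := le (p * (q * p))
  omega

theorem false_of_notMem (h : IsFoldedCode p q r F) (hG : IsGeneralizedDihedral A t) (hp : p ∉ A)
    (hq : q ∉ A) (hr : r ∉ A) : False := by
  have hrp := h.apply_mul_ne_one hG hp hq hr
  have hqp := h.swap₂₃.apply_mul_ne_one hG hp hr hq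
  have hFp := h.apply_eq_zero.1
  have := h.sum p
  rw [hG.mul_self_of_notMem hp, h.one] at this
  omega

theorem false_of_inv_mem (h : IsFoldedCode p q t F) (hG : IsGeneralizedDihedral A t)
    (hp : p⁻¹ ∈ ({p, q} : Set G)) (hq : q⁻¹ ∈ ({p, q} : Set G)) : False := by
  by_cases hpp : p * p = 1
  · have hqq : q * q = 1 := by
      rw [← inv_eq_iff_mul_eq_one] at hpp ⊢
      rcases hq with rfl | hqq
      · rw [← hpp, inv_inv]
      · exact hqq
    by_cases hpA : p ∈ A
    · exact h.swap₁₂.swap₂₃.false_of_involutions hG hpA hqq hG.mul_self hpp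
    by_cases hqA : q ∈ A
    · exact h.swap₂₃.false_of_involutions hG hqA hpp hG.mul_self hqq
    exact h.false_of_notMem hG hpA hqA hG.not_mem
  · obtain rfl : p⁻¹ = q := hp.resolve_left fun hp => hpp (inv_eq_iff_mul_eq_one.1 hp)
    exact h.false_of_inverse_pair hG (by_contra fun hpA => hpp (hG.mul_self_of_notMem hpA))

end IsFoldedCode

theorem IsCodeIndicator.mul_self_ne_one {A : Subgroup G} {S : Set G} {t z : G} {χ : G → ℕ}
    (h : IsCodeIndicator S χ) (hG : IsGeneralizedDihedral A t) (hinv : ∀ s ∈ S, s⁻¹ ∈ S)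
    (hcard : S.ncard = 4) (ht : t ∈ S) (hz : z ∈ S) (hzA : z ∈ A) : z * z ≠ 1 := by
  intro hzz
  have hzt : z ≠ t := fun hzt => hG.not_mem (hzt ▸ hzA)
  have hsub : {z, t} ⊆ S := Set.pair_subset hz ht
  obtain ⟨p, q, -, hpq⟩ : ∃ p q, p ≠ q ∧ S \ {z, t} = {p, q} := by
    rw [← Set.ncard_eq_two, Set.ncard_sdiff hsub, hcard, Set.ncard_pair hzt]
  have hpqinv : ∀ s ∈ ({p, q} : Set G), s⁻¹ ∈ ({p, q} : Set G) := by
    rw [← hpq]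
    rintro s ⟨hs, hszt⟩
    have hzinv : z⁻¹ = z := inv_eq_of_mul_eq_one_left hzz
    have htinv : t⁻¹ = t := inv_eq_of_mul_eq_one_left hG.mul_self
    refine ⟨hinv s hs, ?_⟩
    simpa only [Set.mem_insert_iff, Set.mem_singleton_iff, inv_eq_iff_eq_inv, hzinv, htinv]
      using hszt
  obtain rfl : S = {z, p, q, t} := by
    rw [← Set.sdiff_union_of_subset hsub, hpq]
    grind
  obtain ⟨F, hF⟩ := h.exists_isFoldedCode hcard hzz (hG.commute_of_mul_self hzA hzz)
  exact hF.false_of_inv_mem hG (hpqinv p (by simp)) (hpqinv q (by simp))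

end CentralInvolution

namespace IsGeneralizedDihedral

variable {G : Type*} [Group G] {A : Subgroup G} {t : G} {χ : G → ℕ}

open scoped IsMulCommutative in
theorem five_dvd_of_inverse_pair (hG : IsGeneralizedDihedral A t) {s x : G} (hs : s ∈ A)
    (hx : x ∈ A) (h : IsCodeIndicator {s, s⁻¹, t, t * x} χ)
    (hcard : ({s, s⁻¹, t, t * x} : Set G).ncard = 4) :
    ∃ e : ℤˣ, ∀ i j : ℤ, x ^ i * s ^ j = 1 → 5 ∣ i + e * j := by
  have := hG.isMulCommutative
  lift s to A using hs
  lift x to A using hx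
  have hsum := h.sum_four hcard
  have hladder := five_dvd_of_ladder (B := Additive A) (f := fun a => χ (a.toMul : G))
    (g := fun a => χ (t * (a.toMul : G))) (s := .ofMul s) (x := .ofMul x)
    (fun a => ?_) (fun a => ?_) (by simpa using h.one)
  · have hrel {i j : ℤ} (hij : (x : G) ^ i * (s : G) ^ j = 1) :
        i • Additive.ofMul x + j • Additive.ofMul s = 0 :=
      Additive.toMul.injective (Subtype.ext (by simpa using hij))
    rcases hladder with hd | hd
    · exact ⟨1, fun i j hij => by simpa using hd i j (hrel hij)⟩
    · exact ⟨-1, fun i j hij => by simpa [sub_eq_add_neg] using hd i j (hrel hij)⟩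
  · have := hsum a.toMul
    rw [mul_assoc] at this
    simpa [add_comm a, sub_eq_neg_add] using this
  · have := hsum (t * a.toMul)
    have hts {b : G} (hb : b ∈ A) : b * (t * a.toMul) = t * (b⁻¹ * a.toMul) := by
      rw [← mul_assoc, hG.mul_eq_mul_inv hb hG.not_mem, mul_assoc]
    rw [hG.mul_mul_cancel, hG.mul_mul_mul_eq_inv_mul x.2, hts s.2, hts (inv_mem s.2), inv_inv,
      add_right_comm (χ _)] at this
    simpa [add_comm a, sub_eq_neg_add] using this

open scoped IsMulCommutative in
theorem exists_five_dvd_of_notMem (hG : IsGeneralizedDihedral A t) {e : Fin 4 → G} (he : e 0 = t)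
    (heA : ∀ i, e i ∉ A) {S : Set G} (h : IsCodeIndicator S χ) (hS : Set.range e = S)
    (hcard : S.ncard = 4) : ∃ σ : Equiv.Perm (Fin 4), σ 0 = 0 ∧ ∀ i j k : ℤ,
      (t * e (σ 1)) ^ i * (t * e (σ 2)) ^ j * (t * e (σ 3)) ^ k = 1 → 5 ∣ 2 * i + 3 * j + k := by
  have := hG.isMulCommutative
  set c : Fin 4 → A := fun i => ⟨t * e i, hG.mul_mem_iff.2 (heA i)⟩
  have hsum := h.sum_range hS (by simpa using hcard)
  have hcode : IsBipartiteCode (fun a : Additive A => χ (a.toMul : G))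
      (fun a => χ (t * (a.toMul : G))) (fun i => .ofMul (c i)) := by
    refine ⟨fun a => ?_, fun a => ?_⟩
    · have he (i : Fin 4) : e i * a.toMul = t * (c i * a.toMul) := by
        rw [← mul_assoc t, hG.mul_mul_cancel]
      simpa [add_comm a, he] using hsum a.toMul
    · have he (i : Fin 4) : e i * (t * a.toMul) = (c i : G)⁻¹ * a.toMul := by
        rw [← hG.mul_mul_mul_eq_inv_mul (c i).2, hG.mul_mul_cancel]
      simpa [sub_eq_neg_add, he] using hsum (t * a.toMul)
  obtain ⟨σ, hσ, hdvd⟩ := hcode.exists_perm_five_dvd (a := 0) (by simpa using h.one)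
  refine ⟨σ, hσ, fun i j k hijk => ?_⟩
  have hrel : ∑ u, ![-i - j - k, i, j, k] u • Additive.ofMul (c (σ u)) = 0 := by
    apply Additive.toMul.injective
    apply Subtype.ext
    simpa [Fin.sum_univ_four, hσ, c, he, hG.mul_self] using hijk
  have := hdvd ![-i - j - k, i, j, k] (by
    rw [Fin.sum_univ_four]
    change -i - j - k + i + j + k = 0
    ring) (by simpa [hrel] using h.one)
  change (5 : ℤ) ∣ -i - j - k + 3 * i + 4 * j + 2 * k at this
  omega

end IsGeneralizedDihedral

section Relations

variable {G : Type*} [Group G] {x y z : G} {m l : ℕ} {c d r a b p : ℤ}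

theorem exists_isMinPowMem [Finite G] (x : G) (H : Subgroup G) : ∃ m, IsMinPowMem x H m := by
  have hne : {k : ℕ | 0 < k ∧ x ^ k ∈ H}.Nonempty :=
    ⟨orderOf x, orderOf_pos x, by simp [pow_orderOf_eq_one]⟩
  exact ⟨sInf _, Nat.sInf_mem hne, fun k hk => Nat.sInf_le hk⟩

theorem IsMinPowMem.dvd {H : Subgroup G} (hm : IsMinPowMem x H m) {k : ℤ} (hk : x ^ k ∈ H) :
    (m : ℤ) ∣ k := by
  obtain ⟨⟨hm₀, hm₁⟩, hmin⟩ := hm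
  have hpos : (0 : ℤ) < m := by exact_mod_cast hm₀
  have hr : x ^ (k % m) ∈ H := by
    rw [Int.emod_def, zpow_sub, zpow_mul, zpow_natCast]
    exact mul_mem hk (inv_mem (zpow_mem hm₁ _))
  have hlt := Int.emod_lt_of_pos k hpos
  obtain ⟨r, hr'⟩ := Int.eq_ofNat_of_zero_le (Int.emod_nonneg k hpos.ne')
  rw [hr', zpow_natCast] at hr
  refine Int.dvd_of_emod_eq_zero ?_
  by_contra hne
  have := hmin ⟨by omega, hr⟩
  omega

theorem dvd_of_zpow_mul_zpow_eq_one_iff (hm : IsMinPowMem y (Subgroup.zpowers x) m)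
    (hc : y ^ m = x ^ c) :
    (∀ i j : ℤ, x ^ i * y ^ j = 1 → p ∣ i + a * j) ↔ p ∣ orderOf x ∧ p ∣ c - a * m := by
  constructor
  · intro h
    have hx := h (orderOf x) 0 (by simp [pow_orderOf_eq_one])
    have hy := h c (-m) (by simp [hc])
    exact ⟨by simpa using hx, by rwa [mul_neg, ← sub_eq_add_neg] at hy⟩
  · rintro ⟨hx, hy⟩ i j h
    have hj : y ^ j ∈ Subgroup.zpowers x := by
      rw [← inv_eq_of_mul_eq_one_right h]
      exact inv_mem (zpow_mem (Subgroup.mem_zpowers x) i)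
    obtain ⟨k, rfl⟩ := hm.dvd hj
    rw [zpow_mul, zpow_natCast, hc, ← zpow_mul, ← zpow_add, ← orderOf_dvd_iff_zpow_eq_one] at h
    have hsum := (hx.trans h).sub (hy.mul_right k)
    rwa [show i + c * k - (c - a * m) * k = i + a * (m * k) by ring] at hsum

theorem dvd_of_zpow_mul_zpow_mul_zpow_eq_one_iff (hxy : Commute x y)
    (hm : IsMinPowMem y (Subgroup.zpowers x) m) (hl : IsMinPowMem z (Subgroup.closure {x, y}) l)
    (hc : y ^ m = x ^ c) (hd : z ^ l = x ^ d * y ^ r) :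
    (∀ i j k : ℤ, x ^ i * y ^ j * z ^ k = 1 → p ∣ i + a * j + b * k) ↔
      p ∣ orderOf x ∧ p ∣ c - a * m ∧ p ∣ d + a * r - b * l := by
  have hxy_iff := dvd_of_zpow_mul_zpow_eq_one_iff (a := a) (p := p) hm hc
  constructor
  · intro h
    obtain ⟨hx, hy⟩ := hxy_iff.1 fun i j hij => by simpa using h i j 0 (by simpa using hij)
    have hz := h d r (-l) (by simp [hd])
    exact ⟨hx, hy, by rwa [mul_neg, ← sub_eq_add_neg] at hz⟩
  · rintro ⟨hx, hy, hz⟩ i j k h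
    have hk : z ^ k ∈ Subgroup.closure {x, y} := by
      rw [← inv_eq_of_mul_eq_one_right h]
      exact inv_mem (mul_mem (zpow_mem (Subgroup.subset_closure (by simp)) _)
        (zpow_mem (Subgroup.subset_closure (by simp)) _))
    obtain ⟨q, rfl⟩ := hl.dvd hk
    rw [zpow_mul, zpow_natCast, hd, (hxy.zpow_zpow d r).mul_zpow, ← zpow_mul, ← zpow_mul,
      (hxy.zpow_zpow (d * q) j).symm.mul_mul_mul_comm, ← zpow_add, ← zpow_add] at h
    have hsum := (hxy_iff.2 ⟨hx, hy⟩ _ _ h).sub (hz.mul_right q)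
    rwa [show i + d * q + a * (j + r * q) - (d + a * r - b * l) * q = i + a * j + b * (l * q) by
      ring] at hsum

theorem exists_zpow_mul_add [Finite G] (hp : 0 < p) (hx : p ∣ orderOf x) (hc : p ∣ c - d) :
    ∃ α : ℤ, (0 ≤ α ∧ α ≤ (orderOf x : ℤ) / p - 1) ∧ x ^ c = x ^ (p * α + d) := by
  obtain ⟨n, hn⟩ := hx
  obtain ⟨q, hq⟩ := hc
  have hpos : (0 : ℤ) < orderOf x := by exact_mod_cast orderOf_pos x
  have hn₀ : 0 < n := pos_of_mul_pos_right (hn ▸ hpos) hp.le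
  have hlt := Int.emod_lt_of_pos q hn₀
  rw [hn, Int.mul_ediv_cancel_left _ hp.ne']
  refine ⟨q % n, ⟨Int.emod_nonneg _ hn₀.ne', by omega⟩, ?_⟩
  rw [sub_eq_iff_eq_add.1 hq, zpow_eq_zpow_iff_modEq, hn]
  exact (Int.mod_modEq q n).symm.mul_left'.add_right d

theorem mem_closure_pair_iff_of_commute {g : G} (hxy : Commute x y) :
    g ∈ Subgroup.closure {x, y} ↔ ∃ i j : ℤ, x ^ i * y ^ j = g := by
  have hcomm (m n : Multiplicative ℤ) : Commute (zpowersHom G x m) (zpowersHom G y n) :=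
    hxy.zpow_zpow _ _
  rw [Set.insert_eq, Subgroup.closure_union, ← Subgroup.zpowers_eq_closure,
    ← Subgroup.zpowers_eq_closure, ← Subgroup.range_zpowersHom, ← Subgroup.range_zpowersHom,
    ← MonoidHom.noncommCoprod_range _ _ hcomm]
  simp [MonoidHom.mem_range]

end Relations

section Families

variable {G : Type*} [Group G] {A : Subgroup G} {t : G} {S : Set G}

theorem firstFamily_iff [Finite G] : FirstFamily A t S ↔
    ∃ x ∈ A, ∃ s ∈ A, S = {s, s⁻¹, t, t * x} ∧
      ∃ e : ℤˣ, ∀ i j : ℤ, x ^ i * s ^ j = 1 → 5 ∣ i + e * j := by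
  constructor
  · rintro ⟨x, hx, s, hs, -, m, hS, rfl, hm, h5, u, -, -, ⟨α, rfl⟩, hu | hu⟩
    · exact ⟨x, hx, s, hs, hS, 1, (dvd_of_zpow_mul_zpow_eq_one_iff hm hu).2
        ⟨by exact_mod_cast h5, by simp; omega⟩⟩
    · exact ⟨x, hx, s, hs, hS, -1, (dvd_of_zpow_mul_zpow_eq_one_iff hm hu).2
        ⟨by exact_mod_cast h5, by simp; omega⟩⟩
  · rintro ⟨x, hx, s, hs, hS, e, h⟩
    obtain ⟨m, hm⟩ := exists_isMinPowMem s (Subgroup.zpowers x)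
    obtain ⟨c, hc⟩ := Subgroup.mem_zpowers_iff.mp hm.1.2
    obtain ⟨h5, hcm⟩ := (dvd_of_zpow_mul_zpow_eq_one_iff hm hc.symm).1 h
    obtain ⟨α, ⟨hα₀, hα₁⟩, hα⟩ := exists_zpow_mul_add (by simp) h5 hcm
    refine ⟨x, hx, s, hs, _, m, hS, rfl, hm, by exact_mod_cast h5, 2 * α, by omega,
      by omega, even_two_mul α, ?_⟩
    rw [show 5 * (2 * α) / 2 = 5 * α by omega, ← hc, hα]
    rcases Int.units_eq_one_or e with rfl | rfl
    · exact .inl (by simp)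
    · exact .inr (by simp [sub_eq_add_neg])

theorem secondFamily_of_five_dvd [Finite G] (hG : IsGeneralizedDihedral A t) {x y z : G}
    (hx : x ∈ A) (hy : y ∈ A) (hz : z ∈ A) (hS : S = {t, t * x, t * y, t * z})
    (h : ∀ i j k : ℤ, x ^ i * y ^ j * z ^ k = 1 → 5 ∣ i + 2 * j + 3 * k) :
    SecondFamily A t S := by
  have hxy : Commute x y := hG.comm x hx y hy
  obtain ⟨m, hm⟩ := exists_isMinPowMem y (Subgroup.zpowers x)
  obtain ⟨l, hl⟩ := exists_isMinPowMem z (Subgroup.closure {x, y})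
  obtain ⟨c, hc⟩ := Subgroup.mem_zpowers_iff.mp hm.1.2
  obtain ⟨d, r, hr, hd⟩ : ∃ d r : ℤ, (0 ≤ r ∧ r < m) ∧ z ^ l = x ^ d * y ^ r := by
    obtain ⟨p, r, hpr⟩ := (mem_closure_pair_iff_of_commute hxy).1 hl.1.2
    have hm₀ : (0 : ℤ) < m := by exact_mod_cast hm.1.1
    refine ⟨p + c * (r / m), r % m, ⟨Int.emod_nonneg _ hm₀.ne', Int.emod_lt_of_pos r hm₀⟩, ?_⟩
    rw [← hpr, zpow_add, zpow_mul, hc, mul_assoc, ← zpow_natCast, ← zpow_mul, ← zpow_add,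
      Int.mul_ediv_add_emod]
  obtain ⟨h5, hcm, hdr⟩ := (dvd_of_zpow_mul_zpow_mul_zpow_eq_one_iff hxy hm hl hc.symm hd).1 h
  obtain ⟨α₁, hα₁, e₁⟩ := exists_zpow_mul_add (c := c) (d := -3 * m) (by simp) h5 (by omega)
  obtain ⟨α₂, hα₂, e₂⟩ := exists_zpow_mul_add (c := d) (d := -2 * l + 3 * r) (by simp) h5 (by omega)
  have hparity : parity 4 = 0 := by decide
  refine ⟨x, hx, y, hy, z, hz, _, m, l, hS, rfl, hm, hl, by exact_mod_cast h5, 4, by simp, 3,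
    2, ?_, α₁, α₂, r, hα₁, hα₂, ⟨hr.1, by omega⟩, ?_, ?_⟩
  · rw [hparity]
    exact Set.pair_comm _ _
  · rw [← hc, e₁, neg_mul, sub_eq_add_neg]
  · rw [hd, e₂, ← add_assoc, neg_mul, sub_eq_add_neg]

theorem SecondFamily.exists_five_dvd (hG : IsGeneralizedDihedral A t) (h : SecondFamily A t S) :
    ∃ x ∈ A, ∃ y ∈ A, ∃ z ∈ A, S = {t, t * x, t * y, t * z} ∧ ∃ v a b : ℤ,
      Function.Bijective ![(v : ZMod 5), 0, 1, a, b] ∧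
      ∀ i j k : ℤ, x ^ i * y ^ j * z ^ k = 1 → 5 ∣ i + a * j + b * k := by
  obtain ⟨x, hx, y, hy, z, hz, -, m, l, hS, rfl, hm, hl, h5, v, hv, a, b, hab, α₁, α₂, j, -, -, -,
    hc, hd⟩ := h
  refine ⟨x, hx, y, hy, z, hz, hS, v, -a, -b, ?_,
    (dvd_of_zpow_mul_zpow_mul_zpow_eq_one_iff (hG.comm x hx y hy) hm hl hc hd).2
      ⟨by exact_mod_cast h5, ?_, ?_⟩⟩
  · have h2 : parity 2 = 0 := by decide
    have h3 : parity 3 = 1 := by decide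
    have h4 : parity 4 = 0 := by decide
    rcases hv with rfl | rfl | rfl <;> rw [Set.pair_eq_pair_iff] at hab <;>
      rcases hab with ⟨rfl, rfl⟩ | ⟨rfl, rfl⟩ <;> simp only [h2, h3, h4] <;> decide
  · exact ⟨α₁, by ring⟩
  · exact ⟨α₂, by ring⟩

end Families

section Weights

variable {G : Type*} [Group G]

theorem exists_map_mul_eq_mul {N M : Type*} [Group N] [Group M] (e : N →* G) (c : N →* M)
    (hker : e.ker ≤ c.ker) : ∃ w : G → M, ∀ n g, w (e n * g) = c n * w g := by
  let ρ (g : G) : G := (Quotient.mk (QuotientGroup.rightRel e.range) g).out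
  have hρ (n : N) (g : G) : ρ (e n * g) = ρ g := by
    exact congrArg Quotient.out (Quotient.sound (QuotientGroup.rightRel_apply.2 ⟨n⁻¹, by simp⟩))
  have hrange (g : G) : ∃ n, e n = g * (ρ g)⁻¹ := by
    rw [← MonoidHom.mem_range, ← QuotientGroup.rightRel_apply]
    exact Quotient.mk_out g
  choose ν hν using hrange
  refine ⟨fun g => c (ν g), fun n g => ?_⟩
  have hmem : ν (e n * g) * (n * ν g)⁻¹ ∈ e.ker := by
    rw [MonoidHom.mem_ker, map_mul, map_inv, map_mul, hν, hν, hρ, ← mul_assoc, mul_inv_cancel]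
  have := hker hmem
  rwa [MonoidHom.mem_ker, map_mul, map_inv, map_mul, mul_inv_eq_one] at this

theorem exists_weight {x y z : G} (hxy : Commute x y) (hxz : Commute x z) (hyz : Commute y z)
    {p : ℕ} {a b : ℤ} (h : ∀ i j k : ℤ, x ^ i * y ^ j * z ^ k = 1 → (p : ℤ) ∣ i + a * j + b * k) :
    ∃ w : G → ZMod p, ∀ g, w (x * g) = 1 + w g ∧ w (y * g) = a + w g ∧ w (z * g) = b + w g := by
  let e := ((zpowersHom G x).noncommCoprod (zpowersHom G y) fun _ _ =>
    hxy.zpow_zpow _ _).noncommCoprod (zpowersHom G z) fun _ _ =>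
      (hxz.zpow_zpow _ _).mul_left (hyz.zpow_zpow _ _)
  let c := ((zpowersHom (Multiplicative (ZMod p)) (.ofAdd 1)).coprod
    (zpowersHom _ (.ofAdd (a : ZMod p)))).coprod (zpowersHom _ (.ofAdd (b : ZMod p)))
  have he (i j k : ℤ) : e ((.ofAdd i, .ofAdd j), .ofAdd k) = x ^ i * y ^ j * z ^ k := rfl
  have hc (i j k : ℤ) :
      (c ((.ofAdd i, .ofAdd j), .ofAdd k)).toAdd = ((i + a * j + b * k : ℤ) : ZMod p) := by
    simp [c, mul_comm, add_comm]
  have hker : e.ker ≤ c.ker := fun ⟨⟨i, j⟩, k⟩ hijk => Multiplicative.toAdd.injective <|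
    (hc _ _ _).trans <| (ZMod.intCast_zmod_eq_zero_iff_dvd _ _).2 <|
      h i.toAdd j.toAdd k.toAdd hijk
  obtain ⟨w, hw⟩ := exists_map_mul_eq_mul e c hker
  have hw' (i j k : ℤ) (g : G) : (w (x ^ i * y ^ j * z ^ k * g)).toAdd =
      ((i + a * j + b * k : ℤ) : ZMod p) + (w g).toAdd := by
    rw [← he, hw, toAdd_mul, hc]
  refine ⟨fun g => (w g).toAdd, fun g => ⟨?_, ?_, ?_⟩⟩
  · simpa using hw' 1 0 0 g
  · simpa using hw' 0 1 0 g
  · simpa using hw' 0 0 1 g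

variable {M : Type*} [AddCommGroup M]

theorem isPerfectCode_of_weight {ι : Type*} {S : Set G} {hone : (1 : G) ∉ S}
    {hinv : ∀ s ∈ S, s⁻¹ ∈ S} {s : ι → G} (hs : Set.range s = insert 1 S) {f : ι → M}
    (hf : f.Bijective) {w : G → M}
    (hw : ∀ v, (∃ c, ∀ i, w (s i * v) = f i + c) ∨ ∃ c, ∀ i, w (s i * v) = c - f i) :
    IsPerfectCode (cayleyGraph S hone hinv) {g | w g = 0} := by
  rw [isPerfectCode_cayleyGraph_iff, ← hs]
  intro v
  have hbij : Function.Bijective fun i => w (s i * v) := by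
    obtain ⟨c, hc⟩ | ⟨c, hc⟩ := hw v
    · rw [funext hc]
      exact (Equiv.addRight c).bijective.comp hf
    · rw [funext hc]
      exact (Equiv.subLeft c).bijective.comp hf
  obtain ⟨i, hi, huniq⟩ := hbij.existsUnique 0
  refine ⟨s i, ⟨⟨i, rfl⟩, hi⟩, ?_⟩
  rintro _ ⟨⟨j, rfl⟩, hj⟩
  rw [huniq j hj]

variable {A : Subgroup G} {t : G} {w : G → M} {a k : M} {x u v : G}

open scoped Classical in
/-- The weight on a generalized dihedral group that agrees with `w` on `A` and takes the value
`w u - k` at the reflection `t * u` for `u ∈ A`. -/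
noncomputable def extendWeight (A : Subgroup G) (t : G) (w : G → M) (k : M) (g : G) : M :=
  if g ∈ A then w g else w (t * g) - k

theorem weight_inv_mul (hw : ∀ g, w (x * g) = a + w g) (g : G) : w (x⁻¹ * g) = -a + w g := by
  rw [eq_neg_add_iff_add_eq, ← hw, mul_inv_cancel_left]

theorem extendWeight_mul_of_mem (hx : x ∈ A) (hu : u ∈ A) (hw : ∀ g, w (x * g) = a + w g) :
    extendWeight A t w k (x * u) = a + w u := by
  rw [extendWeight, if_pos (mul_mem hx hu), hw]

namespace IsGeneralizedDihedral

theorem extendWeight_reflection_mul_of_mem (hG : IsGeneralizedDihedral A t) (hx : x ∈ A)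
    (hu : u ∈ A) (hw : ∀ g, w (x * g) = a + w g) :
    extendWeight A t w k (t * x * u) = a + w u - k := by
  rw [mul_assoc, extendWeight, if_neg (mt hG.mul_mem_iff.1 (not_not.2 (mul_mem hx hu))),
    hG.mul_mul_cancel, hw]

theorem extendWeight_mul_of_notMem (hG : IsGeneralizedDihedral A t) (hx : x ∈ A) (hv : v ∉ A)
    (hw : ∀ g, w (x * g) = a + w g) :
    extendWeight A t w k (x * v) = -a + w (t * v) - k := by
  have hxv : x * v ∉ A := mt (mul_mem_cancel_left hx).1 hv
  have htx : t * (x * v) = x⁻¹ * (t * v) := by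
    rw [← hG.mul_mul_mul_eq_inv_mul hx, hG.mul_mul_cancel, mul_assoc]
  rw [extendWeight, if_neg hxv, htx, weight_inv_mul hw]

theorem extendWeight_reflection_mul_of_notMem (hG : IsGeneralizedDihedral A t) (hx : x ∈ A)
    (hv : v ∉ A) (hw : ∀ g, w (x * g) = a + w g) :
    extendWeight A t w k (t * x * v) = -a + w (t * v) := by
  have hu := hG.mul_mem_iff.2 hv
  rw [← hG.mul_mul_cancel v, hG.mul_mul_mul_eq_inv_mul hx, hG.mul_mul_cancel,
    extendWeight_mul_of_mem (inv_mem hx) hu (weight_inv_mul hw)]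

theorem exists_isPerfectCode_of_inverse_pair (hG : IsGeneralizedDihedral A t) {s : G} (hs : s ∈ A)
    (hx : x ∈ A) {S : Set G} (hS : S = {s, s⁻¹, t, t * x}) {hone : (1 : G) ∉ S}
    {hinv : ∀ s ∈ S, s⁻¹ ∈ S} {e : ℤˣ} (h : ∀ i j : ℤ, x ^ i * s ^ j = 1 → 5 ∣ i + e * j) :
    ∃ D, IsPerfectCode (cayleyGraph S hone hinv) D := by
  obtain ⟨w, hw⟩ := exists_weight (p := 5) (a := e) (b := 0) (hG.comm x hx s hs)
    (Commute.one_right x) (Commute.one_right s) (by simpa using h)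
  have hwx g := (hw g).1
  have hws g := (hw g).2.1
  have hws' := weight_inv_mul hws
  have hw1 (g : G) : w (1 * g) = 0 + w g := by rw [one_mul, zero_add]
  have hf : Function.Bijective ![0, ((e : ℤ) : ZMod 5), -((e : ℤ) : ZMod 5), -3, 1 - 3] := by
    rcases Int.units_eq_one_or e with rfl | rfl <;> decide
  have hrange : Set.range ![1, s, s⁻¹, t * 1, t * x] = insert 1 S := by
    simp only [hS, mul_one, Matrix.range_cons, Matrix.range_empty, Set.union_empty,
      Set.singleton_union]
  refine ⟨_, isPerfectCode_of_weight hrange hf (w := extendWeight A t w 3) fun g => ?_⟩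
  by_cases hg : g ∈ A
  · refine Or.inl ⟨w g, fun i => ?_⟩
    fin_cases i
    · exact extendWeight_mul_of_mem A.one_mem hg hw1
    · exact extendWeight_mul_of_mem hs hg hws
    · exact extendWeight_mul_of_mem (inv_mem hs) hg hws'
    · exact (hG.extendWeight_reflection_mul_of_mem A.one_mem hg hw1).trans (by simp; ring)
    · exact (hG.extendWeight_reflection_mul_of_mem hx hg hwx).trans (add_sub_right_comm _ _ _)
  · refine Or.inr ⟨w (t * g) - 3, fun i => ?_⟩
    fin_cases i
    · exact (hG.extendWeight_mul_of_notMem A.one_mem hg hw1).trans (by simp)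
    · exact (hG.extendWeight_mul_of_notMem hs hg hws).trans (by simp; ring)
    · exact (hG.extendWeight_mul_of_notMem (inv_mem hs) hg hws').trans (by simp; ring)
    · exact (hG.extendWeight_reflection_mul_of_notMem A.one_mem hg hw1).trans (by simp)
    · exact (hG.extendWeight_reflection_mul_of_notMem hx hg hwx).trans (by simp; ring)

theorem exists_isPerfectCode_of_reflections (hG : IsGeneralizedDihedral A t) {y z : G} (hx : x ∈ A)
    (hy : y ∈ A) (hz : z ∈ A) {S : Set G} (hS : S = {t, t * x, t * y, t * z}) {hone : (1 : G) ∉ S}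
    {hinv : ∀ s ∈ S, s⁻¹ ∈ S} {v a b : ℤ} (hbij : Function.Bijective ![(v : ZMod 5), 0, 1, a, b])
    (h : ∀ i j k : ℤ, x ^ i * y ^ j * z ^ k = 1 → 5 ∣ i + a * j + b * k) :
    ∃ D, IsPerfectCode (cayleyGraph S hone hinv) D := by
  obtain ⟨w, hw⟩ := exists_weight (hG.comm x hx y hy) (hG.comm x hx z hz) (hG.comm y hy z hz) h
  have hwx g := (hw g).1
  have hwy g := (hw g).2.1
  have hwz g := (hw g).2.2
  have hw1 (g : G) : w (1 * g) = 0 + w g := by rw [one_mul, zero_add]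
  have hrange : Set.range ![1, t * 1, t * x, t * y, t * z] = insert 1 S := by
    simp only [hS, mul_one, Matrix.range_cons, Matrix.range_empty, Set.union_empty,
      Set.singleton_union]
  refine ⟨_, isPerfectCode_of_weight hrange hbij (w := extendWeight A t w v) fun g => ?_⟩
  by_cases hg : g ∈ A
  · refine Or.inl ⟨w g - v, fun i => ?_⟩
    fin_cases i
    · exact (extendWeight_mul_of_mem A.one_mem hg hw1).trans (by simp)
    · exact (hG.extendWeight_reflection_mul_of_mem A.one_mem hg hw1).trans (add_sub_assoc _ _ _)
    · exact (hG.extendWeight_reflection_mul_of_mem hx hg hwx).trans (add_sub_assoc _ _ _)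
    · exact (hG.extendWeight_reflection_mul_of_mem hy hg hwy).trans (add_sub_assoc _ _ _)
    · exact (hG.extendWeight_reflection_mul_of_mem hz hg hwz).trans (add_sub_assoc _ _ _)
  · refine Or.inr ⟨w (t * g), fun i => ?_⟩
    fin_cases i
    · exact (hG.extendWeight_mul_of_notMem A.one_mem hg hw1).trans (by simp)
    · exact (hG.extendWeight_reflection_mul_of_notMem A.one_mem hg hw1).trans (neg_add_eq_sub _ _)
    · exact (hG.extendWeight_reflection_mul_of_notMem hx hg hwx).trans (neg_add_eq_sub _ _)
    · exact (hG.extendWeight_reflection_mul_of_notMem hy hg hwy).trans (neg_add_eq_sub _ _)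
    · exact (hG.extendWeight_reflection_mul_of_notMem hz hg hwz).trans (neg_add_eq_sub _ _)

end IsGeneralizedDihedral

end Weights

section Classification

variable {G : Type*} [Group G] {A : Subgroup G} {t : G} {S : Set G} {χ : G → ℕ}

theorem IsGeneralizedDihedral.eq_inverse_pair_of_mem (hG : IsGeneralizedDihedral A t)
    (hinv : ∀ s ∈ S, s⁻¹ ∈ S) (hcard : S.ncard = 4) (ht : t ∈ S)
    (hinvol : ∀ z ∈ S, z ∈ A → z * z ≠ 1) {s : G} (hs : s ∈ S) (hsA : s ∈ A) :
    ∃ x ∈ A, S = {s, s⁻¹, t, t * x} := by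
  have hss : s ≠ s⁻¹ := fun h => hinvol s hs hsA (mul_eq_one_iff_eq_inv.2 h)
  have hst : s ≠ t := fun h => hG.not_mem (h ▸ hsA)
  have hst' : s⁻¹ ≠ t := fun h => hG.not_mem (h ▸ inv_mem hsA)
  have hsub : {s, s⁻¹, t} ⊆ S :=
    Set.insert_subset hs (Set.insert_subset (hinv s hs) (Set.singleton_subset_iff.2 ht))
  obtain ⟨y, hy⟩ : ∃ y, S \ {s, s⁻¹, t} = {y} := by
    rw [← Set.ncard_eq_one, Set.ncard_sdiff hsub, hcard,
      Set.ncard_eq_three.2 ⟨s, s⁻¹, t, hss, hst, hst', rfl⟩]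
  have hS : S = {s, s⁻¹, t, y} := by
    rw [← Set.sdiff_union_of_subset hsub, hy]
    grind
  obtain ⟨hyS, hy'⟩ : y ∈ S \ {s, s⁻¹, t} := hy ▸ Set.mem_singleton y
  have hyA : y ∉ A := by
    intro hyA
    have hyt : y⁻¹ ≠ t := fun h => hG.not_mem (h ▸ inv_mem hyA)
    have hyy : y⁻¹ ≠ y := fun h => hinvol y hyS hyA (mul_eq_one_iff_eq_inv.2 h.symm)
    have hyinv := hinv y hyS
    simp only [hS, Set.mem_insert_iff, Set.mem_singleton_iff, hyt, hyy, or_false] at hyinv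
    rcases hyinv with h | h
    · exact hy' (by simp [← h])
    · exact hy' (by simp [inv_injective h])
  exact ⟨t * y, hG.mul_mem_iff.2 hyA, by rwa [hG.mul_mul_cancel]⟩

theorem IsCodeIndicator.firstFamily_of_mem [Finite G] (h : IsCodeIndicator S χ)
    (hG : IsGeneralizedDihedral A t) (hinv : ∀ s ∈ S, s⁻¹ ∈ S) (hcard : S.ncard = 4) (ht : t ∈ S)
    {s : G} (hs : s ∈ S) (hsA : s ∈ A) : FirstFamily A t S := by
  obtain ⟨x, hx, rfl⟩ := hG.eq_inverse_pair_of_mem hinv hcard ht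
    (fun z => h.mul_self_ne_one hG hinv hcard ht) hs hsA
  exact firstFamily_iff.2 ⟨x, hx, s, hsA, rfl, hG.five_dvd_of_inverse_pair hsA hx h hcard⟩

theorem IsCodeIndicator.secondFamily_of_disjoint [Finite G] (h : IsCodeIndicator S χ)
    (hG : IsGeneralizedDihedral A t) (hcard : S.ncard = 4) (ht : t ∈ S)
    (hSA : ∀ s ∈ S, s ∉ A) : SecondFamily A t S := by
  obtain ⟨p, q, r, -, -, -, hpqr⟩ := Set.ncard_eq_three.1
    (show (S \ {t}).ncard = 3 by rw [Set.ncard_sdiff_singleton_of_mem ht, hcard])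
  let e : Fin 4 → G := ![t, p, q, r]
  have hrange : Set.range e = S := by
    rw [← Set.insert_eq_of_mem ht, ← Set.insert_sdiff_singleton, hpqr]
    simp only [e, Matrix.range_cons, Matrix.range_empty, Set.union_empty, Set.singleton_union]
  have heA (i : Fin 4) : e i ∉ A := hSA _ (hrange ▸ Set.mem_range_self i)
  obtain ⟨σ, hσ, hdvd⟩ := hG.exists_five_dvd_of_notMem rfl heA h hrange hcard
  have hmem (i : Fin 4) : t * e (σ i) ∈ A := hG.mul_mem_iff.2 (heA _)
  refine secondFamily_of_five_dvd hG (hmem 3) (hmem 1) (hmem 2) ?_ fun i j k hijk => ?_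
  · have he : e ∘ σ = ![t, e (σ 1), e (σ 2), e (σ 3)] := by
      ext i
      fin_cases i <;> simp [hσ, e]
    rw [← hrange, ← σ.surjective.range_comp e, he]
    simp only [hG.mul_mul_cancel, Matrix.range_cons, Matrix.range_empty, Set.union_empty,
      Set.singleton_union]
    rw [Set.insert_comm (e (σ 3)), Set.pair_comm (e (σ 3))]
  · rw [mul_assoc, hG.comm _ (zpow_mem (hmem 3) i) _
      (mul_mem (zpow_mem (hmem 1) j) (zpow_mem (hmem 2) k))] at hijk
    rw [add_assoc, add_comm]
    exact hdvd j k i hijk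

end Classification

theorem theorem1p1_general {G : Type*} [Group G] [Finite G] (A : Subgroup G) (t : G)
    (hG : IsGeneralizedDihedral A t) (S : Set G) (hone : (1 : G) ∉ S)
    (hinv : ∀ s ∈ S, s⁻¹ ∈ S) (hcard : S.ncard = 4) (ht : t ∈ S) :
    (∃ D : Set G, IsPerfectCode (cayleyGraph S hone hinv) D) ↔
      FirstFamily A t S ∨ SecondFamily A t S := by
  constructor
  · rintro ⟨D, hD⟩
    obtain ⟨χ, hχ⟩ := hD.exists_isCodeIndicator S.toFinite
    by_cases hSA : ∀ s ∈ S, s ∉ A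
    · exact .inr (hχ.secondFamily_of_disjoint hG hcard ht hSA)
    · push Not at hSA
      obtain ⟨s, hs, hsA⟩ := hSA
      exact .inl (hχ.firstFamily_of_mem hG hinv hcard ht hs hsA)
  · rintro (h | h)
    · obtain ⟨x, hx, s, hs, hS, e, hdvd⟩ := firstFamily_iff.1 h
      exact hG.exists_isPerfectCode_of_inverse_pair hs hx hS hdvd
    · obtain ⟨x, hx, y, hy, z, hz, hS, v, a, b, hbij, hdvd⟩ := h.exists_five_dvd hG
      exact hG.exists_isPerfectCode_of_reflections hx hy hz hS hbij hdvd

theorem theorem1p1 {G : Type*} [Group G] [Finite G] (A : Subgroup G) (t : G)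
    (hG : IsGeneralizedDihedral A t) (S : Set G) (hone : (1 : G) ∉ S)
    (hinv : ∀ s ∈ S, s⁻¹ ∈ S) (hcard : S.ncard = 4)
    (hconn : (cayleyGraph S hone hinv).Connected) (ht : t ∈ S) :
    (∃ D : Set G, IsPerfectCode (cayleyGraph S hone hinv) D) ↔
      FirstFamily A t S ∨ SecondFamily A t S :=
  theorem1p1_general A t hG S hone hinv hcard ht
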